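/- Let $(M^3,g)$ be a smooth three-dimensional Riemannian manifold with nonnegative Ricci curvature, and let $p\in M$ be a pole, i.e. the exponential map $\exp_p$ is defined on all of $T_pM$ and $\exp_p:T_pM\to M$ is a diffeomorphism. For $t>0$ and a unit vector $\theta\in T_pM$, let $J(t,\theta)$ be the density of the Riemannian volume element in polar normal coordinates $(t,\theta)\mapsto\exp_p(t\theta)$, that is, $d\mu_g=J(t,\theta)\,dt\,d\theta$, where $d\theta$ is the area element of the unit sphere of $T_pM$; explicitly, $J(t,\theta)=t^2\sqrt{\det\big(g(d(\exp_p)_{t\theta}b_i,\,d(\exp_p)_{t\theta}b_j)\big)_{i,j}}$ for any orthonormal basis $b_1,b_2,b_3$ of $T_pM$. Let $J'$ denote the derivative of $J$ with respect to $t$. Then for all $t>0$ and all unit vectors $\theta\in T_pM$, $J(t,\theta)>0$, the function $J(\cdot,\theta)$ is differentiable at $t$, and $$0\le \frac{J'}{J}(t,\theta)\le \frac{2}{t}.$$ -/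

import Mathlib

open Bundle Manifold
open scoped ContDiff

noncomputable section

namespace PoleManifold

section Coordinates

variable {n : ℕ} {M : Type*} [TopologicalSpace M] [ChartedSpace (EuclideanSpace ℝ (Fin n)) M]
  [RiemannianBundle (fun x : M => TangentSpace (𝓡 n) x)]

/-- The `i`-th partial derivative of a real function on `ℝⁿ`. -/
def partialDeriv (i : Fin n) (f : EuclideanSpace ℝ (Fin n) → ℝ)
    (y : EuclideanSpace ℝ (Fin n)) : ℝ :=
  fderiv ℝ f y (EuclideanSpace.single i 1)

/-- The coordinate vector field `∂ᵢ` of the chart `e`, at the point with coordinates `y`. -/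
def coordVector (e : OpenPartialHomeomorph M (EuclideanSpace ℝ (Fin n)))
    (y : EuclideanSpace ℝ (Fin n)) (i : Fin n) : TangentSpace (𝓡 n) (e.symm y) :=
  mfderiv (𝓡 n) (𝓡 n) e.symm y (EuclideanSpace.single i (1 : ℝ) : EuclideanSpace ℝ (Fin n))

/-- The matrix `(g_ij)` of the metric in the chart `e`: `g_ij = g(∂ᵢ, ∂ⱼ)`. -/
def metricMatrix (e : OpenPartialHomeomorph M (EuclideanSpace ℝ (Fin n)))
    (y : EuclideanSpace ℝ (Fin n)) : Matrix (Fin n) (Fin n) ℝ :=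
  Matrix.of fun i j => inner ℝ (coordVector e y i) (coordVector e y j)

/-- The Christoffel symbols `Γᵏ_ij = ½ ∑ₗ gᵏˡ (∂ᵢ g_jl + ∂ⱼ g_il - ∂ₗ g_ij)` of the Levi-Civita
connection in the chart `e`. -/
def christoffel (e : OpenPartialHomeomorph M (EuclideanSpace ℝ (Fin n))) (k i j : Fin n)
    (y : EuclideanSpace ℝ (Fin n)) : ℝ :=
  (1 / 2 : ℝ) * ∑ l, ((metricMatrix e y)⁻¹ k l) *
    (partialDeriv i (fun z => metricMatrix e z j l) y +
      partialDeriv j (fun z => metricMatrix e z i l) y -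
      partialDeriv l (fun z => metricMatrix e z i j) y)

/-- The components of the Ricci tensor in the chart `e`:
`R_ij = ∂ₖ Γᵏ_ij - ∂ⱼ Γᵏ_ik + Γᵏ_kl Γˡ_ij - Γᵏ_jl Γˡ_ik`, summed over `k` and `l`. -/
def ricci (e : OpenPartialHomeomorph M (EuclideanSpace ℝ (Fin n))) (i j : Fin n)
    (y : EuclideanSpace ℝ (Fin n)) : ℝ :=
  (∑ k, (partialDeriv k (christoffel e k i j) y - partialDeriv j (christoffel e k i k) y)) +
    ∑ k, ∑ l, (christoffel e k k l y * christoffel e l i j y -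
      christoffel e k j l y * christoffel e l i k y)

variable (n M) in
/-- Nonnegative Ricci curvature: at every point, `∑ R_ij ξⁱ ξʲ ≥ 0` for every tangent vector with
components `ξ`, in each chart of the smooth structure. (The Ricci tensor being a tensor, the charts
around a given point all express the same condition at it.) -/
def RicciNonneg : Prop :=
  ∀ e ∈ IsManifold.maximalAtlas (𝓡 n) ∞ M, ∀ y ∈ e.target, ∀ ξ : Fin n → ℝ,
    0 ≤ ∑ i, ∑ j, ricci e i j y * ξ i * ξ j

/-- A geodesic defined on the whole real line: a smooth curve whose coordinates `xᵏ` in the charts of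
the smooth structure satisfy `(xᵏ)'' + ∑ Γᵏ_ij (xⁱ)' (xʲ)' = 0`. -/
def IsGeodesic (γ : ℝ → M) : Prop :=
  ContMDiff 𝓘(ℝ, ℝ) (𝓡 n) ∞ γ ∧
    ∀ e ∈ IsManifold.maximalAtlas (𝓡 n) ∞ M, ∀ t : ℝ, γ t ∈ e.source → ∀ k : Fin n,
      deriv (deriv fun s => e (γ s) k) t +
        ∑ i, ∑ j, christoffel e k i j (e (γ t)) *
          deriv (fun s => e (γ s) i) t * deriv (fun s => e (γ s) j) t = 0

end Coordinates

section Exponential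

variable {n : ℕ} {M : Type*} [TopologicalSpace M] [ChartedSpace (EuclideanSpace ℝ (Fin n)) M]
  [RiemannianBundle (fun x : M => TangentSpace (𝓡 n) x)]

/-- `f` is the exponential map at `p`, defined on all of `T_p M`: for every `v`, the curve
`t ↦ f (t v)` is the geodesic starting at `p` with velocity `v`. As geodesics are determined by
their initial position and velocity, there is at most one such `f`. -/
def IsExponentialMap (p : M) (f : TangentSpace (𝓡 n) p → M) : Prop :=
  ∀ v : TangentSpace (𝓡 n) p,
    IsGeodesic (n := n) (fun t : ℝ => f (t • v)) ∧
      tangentMap 𝓘(ℝ, ℝ) (𝓡 n) (fun t : ℝ => f (t • v)) ⟨0, (1 : ℝ)⟩ = ⟨p, v⟩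

variable (n) in
open Classical in
/-- The exponential map `exp_p : T_p M → M` (with the junk value `p` if `exp_p` is not defined on
all of `T_p M`). -/
def expMap (p : M) : TangentSpace (𝓡 n) p → M :=
  if h : ∃ f : TangentSpace (𝓡 n) p → M, IsExponentialMap p f then h.choose else fun _ => p

variable (n) in
/-- `p` is a pole: `exp_p` is defined on all of `T_p M`, and is a smooth diffeomorphism onto `M`. -/
def IsPole (p : M) : Prop :=
  (∃ f : TangentSpace (𝓡 n) p → M, IsExponentialMap p f) ∧
    ∃ Φ : TangentSpace (𝓡 n) p ≃ₘ^∞⟮𝓘(ℝ, TangentSpace (𝓡 n) p), 𝓡 n⟯ M, ⇑Φ = expMap n p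

variable (n) in
/-- The differential of `exp_p` at `v`, as a linear map `T_p M → T_{exp_p v} M`. -/
def dexp (p : M) (v : TangentSpace (𝓡 n) p) :
    TangentSpace (𝓡 n) p →L[ℝ] TangentSpace (𝓡 n) (expMap n p v) :=
  mfderiv 𝓘(ℝ, TangentSpace (𝓡 n) p) (𝓡 n) (expMap n p) v

/-- The tangent spaces are finite dimensional. -/
instance finiteDimensional_tangentSpace (p : M) : FiniteDimensional ℝ (TangentSpace (𝓡 n) p) :=
  inferInstanceAs (FiniteDimensional ℝ (EuclideanSpace ℝ (Fin n)))

variable (n) in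
/-- The Riemannian volume density in normal coordinates at `p`: the function `√(det g_ij)` with
`g_ij = g(dexp_p(v) bᵢ, dexp_p(v) bⱼ)` for an orthonormal basis `b` of `T_p M`, so that `exp_p`
pulls the volume element `dμ_g` back to `normalVolumeDensity n p v dv`, where `dv` is the Lebesgue
measure of the Euclidean space `T_p M`. -/
def normalVolumeDensity (p : M) (v : TangentSpace (𝓡 n) p) : ℝ :=
  let b := stdOrthonormalBasis ℝ (TangentSpace (𝓡 n) p)
  Real.sqrt (Matrix.det (Matrix.of fun i j => inner ℝ (dexp n p v (b i)) (dexp n p v (b j))))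

variable (n) in
/-- The density `J(t, θ)` of the volume element in polar normal coordinates `exp_p (t θ)` at `p`,
where `t > 0` and `θ` is a unit vector of `T_p M`: since `dv = t^(n-1) dt dθ` for `v = t θ`, with
`dθ` the area element of the unit sphere of `T_p M`, it is the function with
`dμ_g = J(t, θ) dt dθ`. -/
def polarDensity (p : M) (t : ℝ) (θ : TangentSpace (𝓡 n) p) : ℝ :=
  t ^ (n - 1) * normalVolumeDensity n p (t • θ)

end Exponential

end PoleManifold

end

/-!
Since `p` is a pole, `exp_p` is the inverse of a single global chart, in which the rays `t ↦ t v` are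
geodesics: `Γᵏ_ij(t v) vⁱ vʲ = 0`. Up to the factor `t ^ (n - 1)`, the polar density is `√det g` along
a ray, so everything takes place in this chart (`IsNormalChart`).

Let `X = yⁱ ∂ᵢ` be the position field and let `B = ∇X - 1`, that is, `Bᵏ_j = Γᵏ_ji yⁱ`
(`radialChristoffel`). Jacobi's formula for the derivative of a determinant identifies the logarithmic
derivative of `J` at `t` with `H = (n - 1 + tr B) / t`, the mean curvature of the geodesic sphere.
Contracting the Ricci tensor twice with `X`, the geodesic equation leaves
`Ric(X, X) = -X(tr B) - tr B - tr B²` (`ricci_radial`). The Gauss lemma (`gauss`) makes `B` self-adjoint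
for `g`, and `B` kills `X`, so Cauchy–Schwarz on the orthogonal complement of `X` gives
`tr B² ≥ (tr B)² / (n - 1)` (`sq_trace_le_of_mulVec_eq_zero`). With `Ric ≥ 0` this is the Riccati
inequality `H' ≤ -H² / (n - 1)` on the whole half-line `(0, ∞)`.

Both bounds follow from this inequality alone, because `1 / H - t / (n - 1)` is nondecreasing wherever
`H` does not vanish: a negative value of `H` would force `H` to blow up to `-∞` in finite time, which
is impossible without conjugate points, and a positive one satisfies `1 / H(t) ≥ t / (n - 1)`. In
particular the behaviour of `J` near `t = 0` plays no role, nor does the normalization of `g` at `p`.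
-/

namespace PoleManifold

/-! ### The scalar Riccati inequality on the half-line -/

/-- If `H' ≤ -H² / c` and `H` does not vanish, then `(1 / H)' = -H' / H² ≥ 1 / c`. -/
lemma monotoneOn_inv_sub_of_riccati {c : ℝ} (hc : 0 < c) {H : ℝ → ℝ} {S : Set ℝ}
    (hS : Convex ℝ S) (hd : ∀ s ∈ S, DifferentiableAt ℝ H s)
    (hR : ∀ s ∈ S, deriv H s ≤ -(H s ^ 2 / c)) (h0 : ∀ s ∈ S, H s ≠ 0) :
    MonotoneOn (fun s => (H s)⁻¹ - s / c) S := by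
  have hder (s) (hs : s ∈ S) : HasDerivAt (fun s => (H s)⁻¹ - s / c)
      (-deriv H s / H s ^ 2 - 1 / c) s :=
    ((hd s hs).hasDerivAt.inv (h0 s hs)).sub ((hasDerivAt_id s).div_const c)
  refine monotoneOn_of_deriv_nonneg hS
    (fun s hs => (hder s hs).continuousAt.continuousWithinAt)
    (fun s hs => (hder s (interior_subset hs)).differentiableAt.differentiableWithinAt) ?_
  intro s hs
  have hs := interior_subset hs
  rw [(hder s hs).deriv, sub_nonneg, div_le_div_iff₀ hc (sq_pos_of_ne_zero (h0 s hs))]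
  have := hR s hs
  have h2 : H s ^ 2 / c * c = H s ^ 2 := by field_simp
  nlinarith

/-- A solution of `H' ≤ -H² / c` that becomes negative blows up to `-∞` in finite time, so one that exists
on all of `(0, ∞)` is nonnegative. -/
lemma nonneg_of_riccati {c : ℝ} (hc : 0 < c) {H : ℝ → ℝ} (hd : ∀ s, 0 < s → DifferentiableAt ℝ H s)
    (hR : ∀ s, 0 < s → deriv H s ≤ -(H s ^ 2 / c)) {t : ℝ} (ht : 0 < t) : 0 ≤ H t := by
  by_contra! hneg
  have hanti : AntitoneOn H (Set.Ici t) := by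
    refine antitoneOn_of_deriv_nonpos (convex_Ici t)
      (fun s hs => (hd s (ht.trans_le hs)).continuousAt.continuousWithinAt) ?_ ?_
    · intro s hs
      rw [interior_Ici] at hs
      exact (hd s (ht.trans hs)).differentiableWithinAt
    · intro s hs
      rw [interior_Ici] at hs
      have := hR s (ht.trans hs)
      have : 0 ≤ H s ^ 2 / c := by positivity
      linarith
  have hlt (s) (hs : t ≤ s) : H s < 0 := (hanti (Set.mem_Ici.2 le_rfl) hs hs).trans_lt hneg
  have hmono := monotoneOn_inv_sub_of_riccati hc (convex_Ici t)
    (fun s hs => hd s (ht.trans_le hs)) (fun s hs => hR s (ht.trans_le hs))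
    (fun s hs => (hlt s hs).ne)
  -- By time `t - c / H t`, the reciprocal of `H` would have increased from `1 / H t` to at least `0`.
  set u := t - c * (H t)⁻¹ with hu
  have hinv : (H t)⁻¹ < 0 := inv_lt_zero.2 hneg
  have htu : t ≤ u := by nlinarith
  have h1 := hmono (Set.mem_Ici.2 le_rfl) htu htu
  have h2 : (H u)⁻¹ < 0 := inv_lt_zero.2 (hlt u htu)
  have h3 : u / c = t / c - (H t)⁻¹ := by rw [hu]; field_simp
  simp only at h1
  linarith

/-- A positive value `H t` persists on `(0, t]`, where `1 / H(t) ≥ 1 / H(s) + (t - s) / c`; let `s → 0`. -/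
lemma le_div_of_riccati {c : ℝ} (hc : 0 < c) {H : ℝ → ℝ} (hd : ∀ s, 0 < s → DifferentiableAt ℝ H s)
    (hR : ∀ s, 0 < s → deriv H s ≤ -(H s ^ 2 / c)) {t : ℝ} (ht : 0 < t) : H t ≤ c / t := by
  rcases le_or_gt (H t) 0 with hle | hpos
  · exact hle.trans (by positivity)
  have hanti : AntitoneOn H (Set.Ioc 0 t) := by
    refine antitoneOn_of_deriv_nonpos (convex_Ioc 0 t)
      (fun s hs => (hd s hs.1).continuousAt.continuousWithinAt)
      (fun s hs => (hd s (interior_subset hs).1).differentiableWithinAt) ?_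
    intro s hs
    have := hR s (interior_subset hs).1
    have : 0 ≤ H s ^ 2 / c := by positivity
    linarith
  have hgt (s) (hs : s ∈ Set.Ioc 0 t) : 0 < H s :=
    hpos.trans_le (hanti hs ⟨ht, le_rfl⟩ hs.2)
  have hmono := monotoneOn_inv_sub_of_riccati hc (convex_Ioc 0 t)
    (fun s hs => hd s hs.1) (fun s hs => hR s hs.1) (fun s hs => (hgt s hs).ne')
  have hbound (s) (hs : s ∈ Set.Ioo 0 t) : (t - s) / c ≤ (H t)⁻¹ := by
    have h1 := hmono ⟨hs.1, hs.2.le⟩ ⟨ht, le_rfl⟩ hs.2.le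
    have h2 : 0 < (H s)⁻¹ := inv_pos.2 (hgt s ⟨hs.1, hs.2.le⟩)
    simp only at h1
    rw [sub_div]
    linarith
  have hlim : t / c ≤ (H t)⁻¹ := by
    have hcont : ContinuousWithinAt (fun s => (t - s) / c) (Set.Ioi 0) 0 := by fun_prop
    have := hcont.tendsto
    rw [sub_zero] at this
    exact le_of_tendsto this (Filter.eventually_of_mem (Ioo_mem_nhdsGT ht) hbound)
  rw [le_div_iff₀ ht]
  rw [div_le_iff₀ hc] at hlim
  have h4 : H t * (H t)⁻¹ = 1 := mul_inv_cancel₀ hpos.ne'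
  nlinarith

section MatrixLemmas

open Matrix

/-! ### Trace inequality, derivative of the determinant, smooth inverses -/

/-- If `C` is self-adjoint for the inner product `G`, it has real eigenvalues, so `tr C² ≥ 0`. -/
lemma trace_sq_nonneg_of_isSymm_mul {n : ℕ} {G C : Matrix (Fin n) (Fin n) ℝ} (hG : G.PosDef)
    (hC : (G * C)ᵀ = G * C) : 0 ≤ (C * C).trace := by
  have hdet : IsUnit G.det := hG.det_pos.ne'.isUnit
  -- With `K = G C`, `tr C² = tr (G⁻¹ (K G⁻¹ K))` is the trace of a product of two positive
  -- semidefinite matrices; the second one is a sum of rank one matrices `v vᵀ`.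
  set K := G * C with hK
  have hCK : C = G⁻¹ * K := by rw [hK, nonsing_inv_mul_cancel_left _ _ hdet]
  have hM : (K * G⁻¹ * K).PosSemidef := by
    have := hG.inv.posSemidef.conjTranspose_mul_mul_same K
    rwa [conjTranspose_eq_transpose_of_trivial, hC] at this
  obtain ⟨m, v, hv⟩ := posSemidef_iff_eq_sum_vecMulVec.1 hM
  have hCC : C * C = G⁻¹ * (K * G⁻¹ * K) := by rw [hCK]; simp only [Matrix.mul_assoc]
  rw [hCC, hv, Finset.mul_sum, trace_sum]
  refine Finset.sum_nonneg fun i _ => ?_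
  rw [mul_vecMulVec, trace_vecMulVec, dotProduct_comm]
  exact hG.inv.posSemidef.dotProduct_mulVec_nonneg (v i)

/-- Cauchy–Schwarz for a `G`-self-adjoint matrix `B` on the `G`-orthogonal complement of a vector `y` in
its kernel: `(tr B)² ≤ (n - 1) tr B²`. -/
lemma sq_trace_le_of_mulVec_eq_zero {n : ℕ} (hn : 2 ≤ n) {G B : Matrix (Fin n) (Fin n) ℝ}
    (hG : G.PosDef) (hB : (G * B)ᵀ = G * B) {y : Fin n → ℝ} (hy : y ≠ 0) (hBy : B *ᵥ y = 0) :
    B.trace ^ 2 / (n - 1 : ℝ) ≤ (B * B).trace := by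
  have hGt : Gᵀ = G := by
    simpa only [conjTranspose_eq_transpose_of_trivial] using hG.isHermitian.eq
  set a := y ⬝ᵥ (G *ᵥ y) with ha
  have hapos : 0 < a := by simpa using hG.dotProduct_mulVec_pos hy
  -- `P` is the `G`-orthogonal projection along `y`; the trace of `(B - l P)²` is nonnegative for
  -- every `l`, and is smallest for `l = tr B / (n - 1)`.
  set P : Matrix (Fin n) (Fin n) ℝ := 1 - a⁻¹ • vecMulVec y (G *ᵥ y) with hP
  have hBP : B * P = B := by
    simp [hP, mul_sub, mul_vecMulVec, hBy]
  have hPB : P * B = B := by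
    have : (G *ᵥ y) ᵥ* B = 0 := by
      rw [← mulVec_transpose, mulVec_mulVec]
      rw [transpose_mul, hGt] at hB
      rw [hB, ← mulVec_mulVec, hBy, mulVec_zero]
    simp [hP, sub_mul, vecMulVec_mul, this]
  have hPP : P * P = P := by
    have : vecMulVec y (G *ᵥ y) * vecMulVec y (G *ᵥ y) = a • vecMulVec y (G *ᵥ y) := by
      rw [vecMulVec_mul_vecMulVec, dotProduct_comm, ← ha]
      ext i j
      simp only [vecMulVec_apply, Matrix.smul_apply, Pi.smul_apply, smul_eq_mul]
      ring
    simp only [hP, sub_mul, mul_sub, one_mul, mul_one, smul_mul_assoc, mul_smul_comm, this,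
      smul_smul, inv_mul_cancel₀ hapos.ne', mul_one]
    simp
  have htP : P.trace = n - 1 := by
    simp only [hP, trace_sub, trace_one, trace_smul, trace_vecMulVec, ← ha]
    simp [hapos.ne']
  have hGP : (G * P)ᵀ = G * P := by
    have : (G * vecMulVec y (G *ᵥ y))ᵀ = G * vecMulVec y (G *ᵥ y) := by
      rw [mul_vecMulVec, transpose_vecMulVec]
    simp only [hP, mul_sub, mul_one, mul_smul_comm, transpose_sub, transpose_smul, this, hGt]
  have hn1 : (0 : ℝ) < n - 1 := by
    have : (2 : ℝ) ≤ n := by exact_mod_cast hn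
    linarith
  set l := B.trace / (n - 1 : ℝ) with hl
  have h := trace_sq_nonneg_of_isSymm_mul (C := B - l • P) hG (by
    simp only [mul_sub, mul_smul_comm, transpose_sub, transpose_smul, hGP, hB])
  have h2 : ((B - l • P) * (B - l • P)).trace =
      (B * B).trace - 2 * l * B.trace + l ^ 2 * (n - 1) := by
    simp only [mul_sub, sub_mul, smul_mul_assoc, mul_smul_comm, hBP, hPB, hPP, trace_sub,
      trace_smul, htP, smul_eq_mul]
    ring
  rw [h2] at h
  have h3 : l * (n - 1) = B.trace := by rw [hl]; field_simp
  have h4 : B.trace ^ 2 / (n - 1 : ℝ) = l * B.trace := by rw [hl]; ring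
  rw [h4]
  have h5 : l ^ 2 * (n - 1 : ℝ) = l * B.trace := by rw [sq, mul_assoc, h3]
  linarith

/-- Jacobi's formula. -/
lemma hasDerivAt_det {n : ℕ} {A : ℝ → Matrix (Fin n) (Fin n) ℝ} {A' : Matrix (Fin n) (Fin n) ℝ}
    {s : ℝ} (hA : ∀ i j, HasDerivAt (fun u => A u i j) (A' i j) s) :
    HasDerivAt (fun u => (A u).det) ((A s).adjugate * A').trace s := by
  have h (σ : Equiv.Perm (Fin n)) := (HasDerivAt.fun_finsetProd (u := Finset.univ)
    fun i _ => hA (σ i) i).const_mul ((Equiv.Perm.sign σ : ℤ) : ℝ)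
  have h2 := HasDerivAt.fun_sum (u := Finset.univ) fun σ _ => h σ
  simp only [det_apply']
  refine h2.congr_deriv ?_
  have h3 (i : Fin n) : ((A s).adjugate * A') i i =
      ∑ σ : Equiv.Perm (Fin n), ((Equiv.Perm.sign σ : ℤ) : ℝ) *
        ((∏ j ∈ Finset.univ.erase i, A s (σ j) j) * A' (σ i) i) := by
    -- By Cramer's rule, the diagonal entries of `adj(A) A'` are the determinants of `A` with one
    -- column replaced by its derivative.
    have h4 : ((A s).adjugate * A') i i = ((A s).updateCol i (fun k => A' k i)).det := by
      rw [← cramer_apply, cramer_eq_adjugate_mulVec]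
      rfl
    rw [h4, det_apply']
    refine Finset.sum_congr rfl fun σ _ => ?_
    rw [← Finset.prod_erase_mul _ _ (Finset.mem_univ i), updateCol_self]
    congr 2
    refine Finset.prod_congr rfl fun j hj => ?_
    rw [updateCol_ne (Finset.ne_of_mem_erase hj)]
  simp only [trace, diag_apply, h3, Finset.mul_sum, smul_eq_mul]
  exact Finset.sum_comm

lemma contDiff_det {n : ℕ} {E : Type*} [NormedAddCommGroup E] [NormedSpace ℝ E]
    {A : E → Matrix (Fin n) (Fin n) ℝ} (hA : ∀ i j, ContDiff ℝ ∞ (fun y => A y i j)) :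
    ContDiff ℝ ∞ (fun y => (A y).det) := by
  have : (fun y => (A y).det) = fun y => ∑ σ : Equiv.Perm (Fin n),
      Equiv.Perm.sign σ • ∏ i, A y (σ i) i := by
    ext y
    exact det_apply _
  rw [this]
  refine ContDiff.sum fun σ _ => ContDiff.const_smul _ (contDiff_prod fun i _ => hA _ _)

lemma contDiff_inv {n : ℕ} {E : Type*} [NormedAddCommGroup E] [NormedSpace ℝ E]
    {A : E → Matrix (Fin n) (Fin n) ℝ} (hA : ∀ i j, ContDiff ℝ ∞ (fun y => A y i j))
    (hdet : ∀ y, (A y).det ≠ 0) (i j : Fin n) :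
    ContDiff ℝ ∞ (fun y => (A y)⁻¹ i j) := by
  simp only [inv_def, Matrix.smul_apply, Ring.inverse_eq_inv', smul_eq_mul, adjugate_apply]
  refine ((contDiff_det hA).inv hdet).mul (contDiff_det fun k l => ?_)
  by_cases hk : k = j
  · subst hk
    simpa only [updateRow_self] using contDiff_const
  · simpa only [updateRow_ne hk] using hA k l

end MatrixLemmas

/-! ### Finite sums and partial derivatives on Euclidean space -/

lemma sum_rotate {ι : Type*} [Fintype ι] (F : ι → ι → ι → ℝ) :
    ∑ i, ∑ j, ∑ k, F i j k = ∑ k, ∑ i, ∑ j, F i j k :=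
  (Finset.sum_congr rfl fun _ _ => Finset.sum_comm).trans Finset.sum_comm

section PartialDeriv

variable {n : ℕ}

lemma fderiv_eq_sum_partialDeriv (f : EuclideanSpace ℝ (Fin n) → ℝ)
    (y v : EuclideanSpace ℝ (Fin n)) :
    fderiv ℝ f y v = ∑ l, v l * partialDeriv l f y := by
  have hv : v = ∑ l, v l • EuclideanSpace.single l (1 : ℝ) := by
    simpa using ((EuclideanSpace.basisFun (Fin n) ℝ).sum_repr v).symm
  conv_lhs => rw [hv]
  simp only [map_sum, map_smul, smul_eq_mul, partialDeriv]

lemma hasDerivAt_comp_smul {f : EuclideanSpace ℝ (Fin n) → ℝ} (hf : Differentiable ℝ f)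
    (v : EuclideanSpace ℝ (Fin n)) (s : ℝ) :
    HasDerivAt (fun u : ℝ => f (u • v)) (∑ l, v l * partialDeriv l f (s • v)) s := by
  have h1 : HasDerivAt (fun u : ℝ => u • v) v s := by
    simpa using (hasDerivAt_id s).smul_const v
  have := (hf (s • v)).hasFDerivAt.comp_hasDerivAt s h1
  rwa [fderiv_eq_sum_partialDeriv] at this

lemma contDiff_partialDeriv {f : EuclideanSpace ℝ (Fin n) → ℝ} (hf : ContDiff ℝ ∞ f) (l : Fin n) :
    ContDiff ℝ ∞ (partialDeriv l f) :=
  (hf.fderiv_right (m := ∞) (by simp)).clm_apply contDiff_const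

lemma contDiff_coord (i : Fin n) : ContDiff ℝ ∞ (fun y : EuclideanSpace ℝ (Fin n) => y i) :=
  (EuclideanSpace.proj (𝕜 := ℝ) i).contDiff

lemma partialDeriv_coord (i m : Fin n) (y : EuclideanSpace ℝ (Fin n)) :
    partialDeriv m (fun z => z i) y = if i = m then 1 else 0 := by
  have : fderiv ℝ (fun z : EuclideanSpace ℝ (Fin n) => z i) y = EuclideanSpace.proj i :=
    (EuclideanSpace.proj (𝕜 := ℝ) i).fderiv
  simp [partialDeriv, this]

lemma partialDeriv_mul {f g : EuclideanSpace ℝ (Fin n) → ℝ} (hf : Differentiable ℝ f)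
    (hg : Differentiable ℝ g) (m : Fin n) (y : EuclideanSpace ℝ (Fin n)) :
    partialDeriv m (fun z => f z * g z) y = partialDeriv m f y * g y + f y * partialDeriv m g y := by
  simp only [partialDeriv, fderiv_fun_mul (hf y) (hg y), _root_.add_apply, _root_.smul_apply,
    smul_eq_mul]
  ring

lemma partialDeriv_sum {ι : Type*} (s : Finset ι) {f : ι → EuclideanSpace ℝ (Fin n) → ℝ}
    (hf : ∀ i, Differentiable ℝ (f i)) (m : Fin n) (y : EuclideanSpace ℝ (Fin n)) :
    partialDeriv m (fun z => ∑ i ∈ s, f i z) y = ∑ i ∈ s, partialDeriv m (f i) y := by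
  simp only [partialDeriv]
  rw [fderiv_fun_sum fun i _ => hf i y]
  simp

/-- The derivative `∂ₘ (fᵢ yⁱ) = (∂ₘ fᵢ) yⁱ + fₘ`, where the coefficients `fᵢ` depend on `y`. -/
lemma partialDeriv_linear {f : Fin n → EuclideanSpace ℝ (Fin n) → ℝ}
    (hf : ∀ i, Differentiable ℝ (f i)) (m : Fin n) (y : EuclideanSpace ℝ (Fin n)) :
    partialDeriv m (fun z => ∑ i, f i z * z i) y = ∑ i, partialDeriv m (f i) y * y i + f m y := by
  have hc (i : Fin n) := (contDiff_coord i).differentiable (by simp)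
  rw [partialDeriv_sum _ fun i => (hf i).fun_mul (hc i)]
  simp only [partialDeriv_mul (hf _) (hc _), partialDeriv_coord, Finset.sum_add_distrib]
  simp

/-- The derivative `∂ₘ (f_ij yⁱ yʲ) = (∂ₘ f_ij) yⁱ yʲ + f_mj yʲ + f_im yⁱ`, where the coefficients `f_ij`
depend on `y`. -/
lemma partialDeriv_quadratic {f : Fin n → Fin n → EuclideanSpace ℝ (Fin n) → ℝ}
    (hf : ∀ i j, Differentiable ℝ (f i j)) (m : Fin n) (y : EuclideanSpace ℝ (Fin n)) :
    partialDeriv m (fun z => ∑ i, ∑ j, f i j z * z i * z j) y =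
      ∑ i, ∑ j, partialDeriv m (f i j) y * y i * y j + ∑ j, f m j y * y j + ∑ i, f i m y * y i := by
  have hc (i : Fin n) := (contDiff_coord i).differentiable (by simp)
  have h (z : EuclideanSpace ℝ (Fin n)) : ∑ i, ∑ j, f i j z * z i * z j =
      ∑ j, (∑ i, f i j z * z i) * z j := by
    simp only [Finset.sum_mul]
    exact Finset.sum_comm
  rw [funext h, partialDeriv_linear fun j => Differentiable.fun_sum fun i _ =>
    (hf i j).fun_mul (hc i)]
  simp only [partialDeriv_linear (hf · _), add_mul, Finset.sum_add_distrib, Finset.sum_mul]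
  rw [Finset.sum_comm]

end PartialDeriv

/-! ### Normal coordinates and the Gauss lemma -/

section NormalChart

open Matrix

variable {n : ℕ} {M : Type*} [TopologicalSpace M] [ChartedSpace (EuclideanSpace ℝ (Fin n)) M]
  [RiemannianBundle (fun x : M => TangentSpace (𝓡 n) x)]
  {e : OpenPartialHomeomorph M (EuclideanSpace ℝ (Fin n))}

/-- Global normal coordinates, as seen through the metric coefficients: these are smooth and positive
definite on all of `ℝⁿ`, and the lines `t ↦ t v` through the origin solve the geodesic equation. No
normalization `g_ij(0) = δ_ij` is imposed. The conditions at `y` concern the metric at `e.symm y`, so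
they are meaningful when `e.target` is everything. -/
structure IsNormalChart (e : OpenPartialHomeomorph M (EuclideanSpace ℝ (Fin n))) : Prop where
  contDiff_metric : ∀ i j, ContDiff ℝ ∞ (fun y => metricMatrix e y i j)
  posDef_metric : ∀ y, (metricMatrix e y).PosDef
  radial : ∀ (t : ℝ) (v : EuclideanSpace ℝ (Fin n)) (k : Fin n),
    ∑ i, ∑ j, christoffel e k i j (t • v) * v i * v j = 0

/-- The partial derivative `∂ₗ g_ij` of the metric coefficients in the chart `e`. -/
noncomputable def metricDeriv (e : OpenPartialHomeomorph M (EuclideanSpace ℝ (Fin n)))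
    (l i j : Fin n) (y : EuclideanSpace ℝ (Fin n)) : ℝ :=
  partialDeriv l (fun z => metricMatrix e z i j) y

lemma metricMatrix_symm (y : EuclideanSpace ℝ (Fin n)) (i j : Fin n) :
    metricMatrix e y i j = metricMatrix e y j i :=
  real_inner_comm (coordVector e y j) (coordVector e y i)

lemma metricDeriv_symm (l i j : Fin n) (y : EuclideanSpace ℝ (Fin n)) :
    metricDeriv e l i j y = metricDeriv e l j i y := by
  simp only [metricDeriv, metricMatrix_symm _ i j]

lemma christoffel_symm (k i j : Fin n) (y : EuclideanSpace ℝ (Fin n)) :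
    christoffel e k i j y = christoffel e k j i y := by
  simp only [christoffel, metricMatrix_symm _ i j]
  congr 1
  refine Finset.sum_congr rfl fun l _ => ?_
  ring

/-- The matrix `Bᵏ_j = Γᵏ_ji yⁱ` at `y`. It represents `∇X - 1`, where `X = yⁱ ∂ᵢ` is the position
vector field. -/
noncomputable def radialChristoffel (e : OpenPartialHomeomorph M (EuclideanSpace ℝ (Fin n)))
    (y : EuclideanSpace ℝ (Fin n)) : Matrix (Fin n) (Fin n) ℝ :=
  Matrix.of fun k j => ∑ i, christoffel e k j i y * y i

lemma trace_radialChristoffel (y : EuclideanSpace ℝ (Fin n)) :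
    (radialChristoffel e y).trace = ∑ i, (∑ k, christoffel e k k i y) * y i := by
  simp only [trace, diag_apply, radialChristoffel, of_apply, Finset.sum_mul]
  exact Finset.sum_comm

namespace IsNormalChart

lemma differentiable_metric (he : IsNormalChart e) (i j : Fin n) :
    Differentiable ℝ (fun y => metricMatrix e y i j) :=
  (he.contDiff_metric i j).differentiable (by simp)

lemma contDiff_christoffel (he : IsNormalChart e) (k i j : Fin n) :
    ContDiff ℝ ∞ (christoffel e k i j) := by
  refine contDiff_const.mul (ContDiff.sum fun l _ => ?_)
  have h (a b c : Fin n) := contDiff_partialDeriv (he.contDiff_metric a b) c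
  exact (contDiff_inv he.contDiff_metric (fun y => (he.posDef_metric y).det_pos.ne') k l).mul
    (((h _ _ _).add (h _ _ _)).sub (h _ _ _))

/-- The Christoffel symbols with the upper index lowered. -/
lemma sum_metric_mul_christoffel (he : IsNormalChart e) (m i j : Fin n)
    (y : EuclideanSpace ℝ (Fin n)) :
    ∑ k, metricMatrix e y m k * christoffel e k i j y =
      (1 / 2) * (metricDeriv e i j m y + metricDeriv e j i m y - metricDeriv e m i j y) := by
  set u : Fin n → ℝ := fun l => (1 / 2) *
    (metricDeriv e i j l y + metricDeriv e j i l y - metricDeriv e l i j y) with hu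
  have hΓ : (fun k => christoffel e k i j y) = (metricMatrix e y)⁻¹ *ᵥ u := by
    ext k
    simp only [christoffel, mulVec, dotProduct, Finset.mul_sum, hu, metricDeriv]
    refine Finset.sum_congr rfl fun l _ => ?_
    ring
  have : metricMatrix e y *ᵥ (fun k => christoffel e k i j y) = u := by
    rw [hΓ, mulVec_mulVec, mul_nonsing_inv _ (he.posDef_metric y).det_pos.ne'.isUnit, one_mulVec]
  exact congrFun this m

/-- The geodesic equation of the rays, with the index lowered: `∂ᵢ g_mj vⁱ vʲ = ½ ∂ₘ g_ij vⁱ vʲ` at `t v`. -/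
lemma radial_metricDeriv (he : IsNormalChart e) (t : ℝ) (v : EuclideanSpace ℝ (Fin n))
    (m : Fin n) :
    ∑ i, ∑ j, metricDeriv e i m j (t • v) * v i * v j =
      (1 / 2) * ∑ i, ∑ j, metricDeriv e m i j (t • v) * v i * v j := by
  have h : ∑ i, ∑ j, (∑ k, metricMatrix e (t • v) m k * christoffel e k i j (t • v)) * v i * v j
      = 0 := by
    calc _ = ∑ k, metricMatrix e (t • v) m k *
          ∑ i, ∑ j, christoffel e k i j (t • v) * v i * v j := by
          simp only [Finset.sum_mul, Finset.mul_sum]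
          rw [sum_rotate]
          simp only [mul_assoc]
      _ = 0 := by simp only [he.radial, mul_zero, Finset.sum_const_zero]
  have hsw : ∑ i, ∑ j, metricDeriv e j i m (t • v) * v i * v j =
      ∑ i, ∑ j, metricDeriv e i m j (t • v) * v i * v j := by
    rw [Finset.sum_comm]
    refine Finset.sum_congr rfl fun i _ => Finset.sum_congr rfl fun j _ => ?_
    rw [metricDeriv_symm]
    ring
  simp only [he.sum_metric_mul_christoffel, mul_assoc, ← Finset.mul_sum, sub_mul, add_mul,
    Finset.sum_add_distrib, Finset.sum_sub_distrib] at h hsw ⊢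
  simp only [metricDeriv_symm _ _ m] at h hsw ⊢
  linarith

/-- Rays have constant speed: `g_ij(v) vⁱ vʲ = g_ij(0) vⁱ vʲ`. -/
lemma metric_radial_eq (he : IsNormalChart e) (v : EuclideanSpace ℝ (Fin n)) :
    ∑ i, ∑ j, metricMatrix e v i j * v i * v j =
      ∑ i, ∑ j, metricMatrix e 0 i j * v i * v j := by
  -- Contracting the lowered geodesic equation once more with `v` gives `Z = ½ Z` for
  -- `Z = ∂ₗ g_ij vˡ vⁱ vʲ`, the derivative of the squared speed.
  have hZ (s : ℝ) : ∑ i, ∑ j, (∑ l, v l * metricDeriv e l i j (s • v)) * v i * v j = 0 := by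
    have h1 : ∑ m, v m * ∑ i, ∑ j, metricDeriv e i m j (s • v) * v i * v j =
        ∑ i, ∑ j, (∑ l, v l * metricDeriv e l i j (s • v)) * v i * v j := by
      simp only [Finset.mul_sum, Finset.sum_mul]
      rw [Finset.sum_comm, ← sum_rotate]
      refine Finset.sum_congr rfl fun i _ => Finset.sum_congr rfl fun j _ =>
        Finset.sum_congr rfl fun k _ => ?_
      ring
    have h2 : ∑ m, v m * ∑ i, ∑ j, metricDeriv e m i j (s • v) * v i * v j =
        ∑ i, ∑ j, (∑ l, v l * metricDeriv e l i j (s • v)) * v i * v j := by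
      simp only [Finset.mul_sum, Finset.sum_mul]
      rw [← sum_rotate]
      refine Finset.sum_congr rfl fun i _ => Finset.sum_congr rfl fun j _ =>
        Finset.sum_congr rfl fun k _ => ?_
      ring
    simp only [he.radial_metricDeriv, mul_left_comm _ (1 / 2 : ℝ), ← Finset.mul_sum] at h1
    linarith
  have hd (s : ℝ) : HasDerivAt
      (fun u : ℝ => ∑ i, ∑ j, metricMatrix e (u • v) i j * v i * v j) 0 s := by
    rw [← hZ s]
    exact HasDerivAt.fun_sum fun i _ => HasDerivAt.fun_sum fun j _ =>
      ((hasDerivAt_comp_smul (he.differentiable_metric i j) v s).mul_const _).mul_const _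
  have := is_const_of_deriv_eq_zero (fun s => (hd s).differentiableAt) (fun s => (hd s).deriv) 1 0
  simpa using this

/-- The derivative `∂ₘ` of the identity `g_ij(y) yⁱ yʲ = g_ij(0) yⁱ yʲ`. -/
lemma metricDeriv_quadratic (he : IsNormalChart e) (y : EuclideanSpace ℝ (Fin n)) (m : Fin n) :
    ∑ i, ∑ j, metricDeriv e m i j y * y i * y j + 2 * ∑ j, metricMatrix e y m j * y j =
      2 * ∑ j, metricMatrix e 0 m j * y j := by
  have h1 := partialDeriv_quadratic he.differentiable_metric m y
  have h2 := partialDeriv_quadratic (f := fun i j _ => metricMatrix e 0 i j)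
    (fun i j => differentiable_const _) m y
  rw [funext he.metric_radial_eq, h2] at h1
  have h0 (i j) : partialDeriv m (fun _ => metricMatrix e 0 i j) y = 0 := by
    simp [partialDeriv]
  simp only [h0, zero_mul, Finset.sum_const_zero, zero_add, metricMatrix_symm _ _ m] at h1
  simp only [metricDeriv]
  linarith

/-- The Gauss lemma: `g_mj(v) vʲ = g_mj(0) vʲ`. Along the ray, with `ψ(s) = g_mj(s v) vʲ`, the geodesic
equation and the derivative of the constant speed identity combine to `(s ψ)' = ψ(0)`. -/
lemma gauss (he : IsNormalChart e) (v : EuclideanSpace ℝ (Fin n)) (m : Fin n) :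
    ∑ j, metricMatrix e v m j * v j = ∑ j, metricMatrix e 0 m j * v j := by
  set c := ∑ j, metricMatrix e 0 m j * v j with hc
  have hd (s : ℝ) : HasDerivAt (fun u : ℝ => ∑ j, metricMatrix e (u • v) m j * v j)
      (∑ j, (∑ l, v l * metricDeriv e l m j (s • v)) * v j) s :=
    HasDerivAt.fun_sum fun j _ =>
      (hasDerivAt_comp_smul (he.differentiable_metric m j) v s).mul_const _
  have hd2 (s : ℝ) : HasDerivAt (fun u : ℝ => u * ∑ j, metricMatrix e (u • v) m j * v j - u * c)
      0 s := by
    refine (((hasDerivAt_id s).mul (hd s)).sub ((hasDerivAt_id s).mul_const c)).congr_deriv ?_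
    have h1 : ∑ j, (∑ l, v l * metricDeriv e l m j (s • v)) * v j =
        ∑ i, ∑ j, metricDeriv e i m j (s • v) * v i * v j := by
      rw [Finset.sum_comm]
      simp only [Finset.sum_mul]
      refine Finset.sum_congr rfl fun i _ => Finset.sum_congr rfl fun j _ => ?_
      ring
    rw [h1, he.radial_metricDeriv]
    have h2 := he.metricDeriv_quadratic (s • v) m
    -- The derivative of the speed identity at `s v` carries a factor `s`, so `s = 0` is separate.
    rcases eq_or_ne s 0 with rfl | hs
    · simp [hc]
    · have h3 : ∑ i, ∑ j, metricDeriv e m i j (s • v) * (s • v) i * (s • v) j =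
          s ^ 2 * ∑ i, ∑ j, metricDeriv e m i j (s • v) * v i * v j := by
        simp only [Finset.mul_sum]
        refine Finset.sum_congr rfl fun i _ => Finset.sum_congr rfl fun j _ => ?_
        simp only [PiLp.smul_apply, smul_eq_mul]
        ring
      have h4 (x) : ∑ j, metricMatrix e x m j * (s • v) j =
          s * ∑ j, metricMatrix e x m j * v j := by
        simp only [Finset.mul_sum]
        refine Finset.sum_congr rfl fun i _ => ?_
        simp only [PiLp.smul_apply, smul_eq_mul]
        ring
      rw [h3, h4, h4, ← hc] at h2
      simp only [id, one_mul]
      apply mul_left_cancel₀ hs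
      linarith
  have := is_const_of_deriv_eq_zero (fun s => (hd2 s).differentiableAt)
    (fun s => (hd2 s).deriv) 1 0
  simp only [one_smul, one_mul, zero_mul, sub_zero] at this
  linarith

/-- The derivative of the Gauss lemma: `∂ᵢ g_mj yʲ = g_mi(0) - g_mi(y)` is symmetric in `i` and `m`. -/
lemma metricDeriv_radial_symm (he : IsNormalChart e) (y : EuclideanSpace ℝ (Fin n))
    (i m : Fin n) :
    ∑ j, metricDeriv e i m j y * y j = ∑ j, metricDeriv e m i j y * y j := by
  have key (i m : Fin n) : ∑ j, metricDeriv e i m j y * y j + metricMatrix e y m i =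
      metricMatrix e 0 m i := by
    have h1 := partialDeriv_linear (he.differentiable_metric m) i y
    have h2 := partialDeriv_linear (f := fun j _ => metricMatrix e 0 m j)
      (fun j => differentiable_const _) i y
    rw [funext fun z => he.gauss z m, h2] at h1
    have h0 (j) : partialDeriv i (fun _ => metricMatrix e 0 m j) y = 0 := by
      simp [partialDeriv]
    simp only [h0, zero_mul, Finset.sum_const_zero, zero_add] at h1
    exact h1.symm
  have h1 := key i m
  have h2 := key m i
  rw [metricMatrix_symm y i m, metricMatrix_symm 0 i m] at h2
  linarith

/-! ### The Riccati inequality along rays -/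

/-- The position vector is in the kernel of `B`. -/
lemma radialChristoffel_mulVec (he : IsNormalChart e) (y : EuclideanSpace ℝ (Fin n)) :
    radialChristoffel e y *ᵥ y = 0 := by
  ext k
  have := he.radial 1 y k
  simp only [one_smul] at this
  simp only [mulVec, dotProduct, radialChristoffel, of_apply, Finset.sum_mul, Pi.zero_apply]
  rw [← this]
  refine Finset.sum_congr rfl fun i _ => Finset.sum_congr rfl fun j _ => ?_
  ring

/-- By the Gauss lemma, two of the three terms of the lowered `g B` cancel, leaving half the radial
derivative of `g`; in particular `g B` is symmetric. -/
lemma metric_mul_radialChristoffel (he : IsNormalChart e) (y : EuclideanSpace ℝ (Fin n))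
    (m j : Fin n) :
    (metricMatrix e y * radialChristoffel e y) m j = (1 / 2) * ∑ l, y l * metricDeriv e l m j y := by
  have h1 : (metricMatrix e y * radialChristoffel e y) m j =
      ∑ i, (∑ k, metricMatrix e y m k * christoffel e k j i y) * y i := by
    simp only [mul_apply, radialChristoffel, of_apply, Finset.mul_sum, Finset.sum_mul]
    rw [Finset.sum_comm]
    simp only [mul_assoc]
  have h2 := he.metricDeriv_radial_symm y j m
  simp only [h1, he.sum_metric_mul_christoffel, mul_assoc, ← Finset.mul_sum, sub_mul, add_mul,
    Finset.sum_add_distrib, Finset.sum_sub_distrib]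
  simp only [metricDeriv_symm _ _ m, mul_comm (y _)] at h2 ⊢
  simp only [metricDeriv_symm m j] at h2 ⊢
  linarith

lemma differentiable_christoffel (he : IsNormalChart e) (k i j : Fin n) :
    Differentiable ℝ (christoffel e k i j) :=
  (he.contDiff_christoffel k i j).differentiable (by simp)

lemma differentiable_trace_radialChristoffel (he : IsNormalChart e) :
    Differentiable ℝ (fun y => (radialChristoffel e y).trace) := by
  simp only [trace_radialChristoffel]
  exact Differentiable.fun_sum fun i _ =>
    (Differentiable.fun_sum fun k _ => he.differentiable_christoffel k k i).fun_mul
      ((contDiff_coord i).differentiable (by simp))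

/-- The Ricci tensor in the radial direction: `Ric(X, X) = -X(tr B) - tr B - tr B²`. Only the geodesic
equation `Γᵏ_ij yⁱ yʲ = 0`, as an identity in `y`, enters. -/
lemma ricci_radial (he : IsNormalChart e) (y : EuclideanSpace ℝ (Fin n)) :
    ∑ i, ∑ j, ricci e i j y * y i * y j =
      -(∑ m, y m * partialDeriv m (fun z => (radialChristoffel e z).trace) y) -
        (radialChristoffel e y).trace - (radialChristoffel e y * radialChristoffel e y).trace := by
  have hrad (y : EuclideanSpace ℝ (Fin n)) (k : Fin n) :
      ∑ i, ∑ j, christoffel e k i j y * y i * y j = 0 := by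
    simpa using he.radial 1 y k
  have hΓ := he.differentiable_christoffel
  -- The first term of the Ricci tensor, from the derivative of `Γᵏ_ij yⁱ yʲ = 0`.
  have ha : ∑ i, ∑ j, (∑ k, partialDeriv k (christoffel e k i j) y) * y i * y j =
      -2 * (radialChristoffel e y).trace := by
    have h1 (k : Fin n) := partialDeriv_quadratic (hΓ k) k y
    have h0 (k : Fin n) : partialDeriv k
        (fun z => ∑ i, ∑ j, christoffel e k i j z * z i * z j) y = 0 := by
      rw [funext fun z => hrad z k]
      simp [partialDeriv]
    have h2 : ∑ i, ∑ j, (∑ k, partialDeriv k (christoffel e k i j) y) * y i * y j =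
        ∑ k, ∑ i, ∑ j, partialDeriv k (christoffel e k i j) y * y i * y j := by
      simp only [Finset.sum_mul]
      exact sum_rotate _
    have h3 (k : Fin n) : ∑ i, ∑ j, partialDeriv k (christoffel e k i j) y * y i * y j =
        -2 * radialChristoffel e y k k := by
      have h4 : ∑ i, christoffel e k i k y * y i = ∑ i, christoffel e k k i y * y i :=
        Finset.sum_congr rfl fun i _ => by rw [christoffel_symm]
      have h5 := h1 k
      rw [h0, h4] at h5
      simp only [radialChristoffel, of_apply]
      linarith
    simp only [h2, h3, ← Finset.mul_sum, trace, diag_apply]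
  -- The second term, from the derivative of `tr B = Γᵏ_ki yⁱ`.
  have hb : ∑ i, ∑ j, (∑ k, partialDeriv j (christoffel e k i k) y) * y i * y j =
      ∑ m, y m * partialDeriv m (fun z => (radialChristoffel e z).trace) y -
        (radialChristoffel e y).trace := by
    have h1 (m : Fin n) : partialDeriv m (fun z => (radialChristoffel e z).trace) y =
        ∑ i, (∑ k, partialDeriv m (christoffel e k i k) y) * y i +
          ∑ k, christoffel e k k m y := by
      rw [funext trace_radialChristoffel, partialDeriv_linear fun i =>
        Differentiable.fun_sum fun k _ => hΓ k k i]
      congr 1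
      refine Finset.sum_congr rfl fun i _ => ?_
      rw [partialDeriv_sum _ fun k => hΓ k k i]
      simp only [funext (christoffel_symm _ i _)]
    simp only [h1]
    rw [trace_radialChristoffel, Finset.sum_comm]
    simp only [mul_comm (y _), ← Finset.sum_mul, add_mul, Finset.sum_add_distrib,
      add_sub_cancel_right]
  -- The third term vanishes by the geodesic equation, and the fourth one is `tr B²`.
  have hc : ∑ i, ∑ j, (∑ k, ∑ l, christoffel e k k l y * christoffel e l i j y) * y i * y j =
      0 := by
    have h1 : ∑ i, ∑ j, (∑ l, (∑ k, christoffel e k k l y) * christoffel e l i j y) *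
        y i * y j = ∑ l, (∑ k, christoffel e k k l y) *
          ∑ i, ∑ j, christoffel e l i j y * y i * y j := by
      have (c : Fin n → ℝ) : ∑ i, ∑ j, (∑ l, c l * christoffel e l i j y) *
        y i * y j = ∑ l, c l * ∑ i, ∑ j, christoffel e l i j y * y i * y j := by
        simp only [Finset.sum_mul, Finset.mul_sum]
        rw [sum_rotate]
        simp only [mul_assoc]
      exact this _
    simp only [hrad, mul_zero, Finset.sum_const_zero] at h1
    rw [← h1]
    refine Finset.sum_congr rfl fun i _ => Finset.sum_congr rfl fun j _ => ?_
    rw [Finset.sum_comm]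
    simp only [Finset.sum_mul]
  have hd : ∑ i, ∑ j, (∑ k, ∑ l, christoffel e k j l y * christoffel e l i k y) * y i * y j =
      (radialChristoffel e y * radialChristoffel e y).trace := by
    simp only [trace, diag_apply, mul_apply, radialChristoffel, of_apply, Finset.sum_mul]
    rw [sum_rotate]
    refine Finset.sum_congr rfl fun k _ => ?_
    rw [sum_rotate]
    refine Finset.sum_congr rfl fun l _ => ?_
    rw [Finset.sum_comm]
    simp only [Finset.mul_sum]
    refine Finset.sum_congr rfl fun j _ => Finset.sum_congr rfl fun i _ => ?_
    rw [christoffel_symm k, christoffel_symm l]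
    ring
  simp only [ricci, add_mul, Finset.sum_sub_distrib, sub_mul, Finset.sum_add_distrib, ha, hb, hc, hd]
  ring

/-- The Riccati inequality `X(tr B) ≤ -tr B - (tr B)² / (n - 1)` at a point where `Ric(X, X) ≥ 0`. -/
lemma riccati_trace_radialChristoffel (he : IsNormalChart e) (hn : 2 ≤ n)
    {y : EuclideanSpace ℝ (Fin n)} (hy : y ≠ 0)
    (hRic : 0 ≤ ∑ i, ∑ j, ricci e i j y * y i * y j) :
    ∑ m, y m * partialDeriv m (fun z => (radialChristoffel e z).trace) y ≤
      -(radialChristoffel e y).trace - (radialChristoffel e y).trace ^ 2 / (n - 1 : ℝ) := by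
  have hsymm : (metricMatrix e y * radialChristoffel e y)ᵀ =
      metricMatrix e y * radialChristoffel e y := by
    ext i j
    rw [transpose_apply, he.metric_mul_radialChristoffel, he.metric_mul_radialChristoffel]
    simp only [metricDeriv_symm _ i j]
  have h := sq_trace_le_of_mulVec_eq_zero hn (he.posDef_metric y) hsymm
    (y := y) (fun h => hy (by ext i; exact congrFun h i)) (he.radialChristoffel_mulVec y)
  rw [he.ricci_radial] at hRic
  linarith

/-- Along a ray, `(log det g)' = 2 tr B / s`. -/
lemma hasDerivAt_det_metricMatrix (he : IsNormalChart e) (v : EuclideanSpace ℝ (Fin n)) {s : ℝ}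
    (hs : s ≠ 0) :
    HasDerivAt (fun u : ℝ => (metricMatrix e (u • v)).det)
      ((metricMatrix e (s • v)).det * (2 * (radialChristoffel e (s • v)).trace / s)) s := by
  have h1 := hasDerivAt_det (A := fun u : ℝ => metricMatrix e (u • v))
    (A' := (2 / s) • (metricMatrix e (s • v) * radialChristoffel e (s • v))) (s := s) (fun i j => by
      refine (hasDerivAt_comp_smul (he.differentiable_metric i j) v s).congr_deriv ?_
      rw [Matrix.smul_apply, he.metric_mul_radialChristoffel]
      simp only [PiLp.smul_apply, smul_eq_mul, mul_assoc, ← Finset.mul_sum, metricDeriv]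
      field_simp)
  refine h1.congr_deriv ?_
  rw [mul_smul_comm, ← Matrix.mul_assoc, adjugate_mul, smul_mul_assoc,
    Matrix.one_mul, trace_smul, trace_smul]
  simp only [smul_eq_mul]
  ring

/-- The logarithmic derivative of the polar density `s ^ (n - 1) √det g` is `(n - 1 + tr B) / s`. -/
lemma hasDerivAt_pow_mul_sqrt_det (he : IsNormalChart e) (hn : 1 ≤ n)
    (v : EuclideanSpace ℝ (Fin n)) {s : ℝ} (hs : 0 < s) :
    HasDerivAt (fun u : ℝ => u ^ (n - 1) * √(metricMatrix e (u • v)).det)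
      (s ^ (n - 1) * √(metricMatrix e (s • v)).det *
        ((n - 1 + (radialChristoffel e (s • v)).trace) / s)) s := by
  have hpos := (he.posDef_metric (s • v)).det_pos
  have h1 := (he.hasDerivAt_det_metricMatrix v hs.ne').sqrt hpos.ne'
  refine ((hasDerivAt_pow (n - 1) s).mul h1).congr_deriv ?_
  have h2 : ((n - 1 : ℕ) : ℝ) * s ^ (n - 1 - 1) = s ^ (n - 1) * ((n - 1 : ℝ) / s) := by
    -- For `n = 1` the truncated exponent is harmless, since the coefficient is `0`.
    rcases Nat.exists_eq_add_of_le hn with ⟨m, rfl⟩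
    rcases m with _ | m
    · simp
    · simp only [Nat.add_sub_cancel_left, Nat.add_sub_cancel, pow_succ]
      push_cast
      field_simp
      ring
  have h3 : (metricMatrix e (s • v)).det =
      √(metricMatrix e (s • v)).det * √(metricMatrix e (s • v)).det :=
    (Real.mul_self_sqrt hpos.le).symm
  have h4 : 0 < √(metricMatrix e (s • v)).det := Real.sqrt_pos.2 hpos
  have h5 : (metricMatrix e (s • v)).det * (2 * (radialChristoffel e (s • v)).trace / s) /
      (2 * √(metricMatrix e (s • v)).det) =
      √(metricMatrix e (s • v)).det * ((radialChristoffel e (s • v)).trace / s) := by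
    rw [div_eq_iff (by positivity)]
    conv_lhs => rw [h3]
    ring
  rw [h2, h5]
  ring

/-- The mean curvature `H = (n - 1 + tr B) / t` of the geodesic spheres satisfies `0 ≤ H ≤ (n - 1) / t` if
the radial Ricci curvatures are nonnegative. -/
lemma meanCurvature_bounds (he : IsNormalChart e) (hn : 2 ≤ n)
    (hRic : ∀ y, 0 ≤ ∑ i, ∑ j, ricci e i j y * y i * y j)
    {v : EuclideanSpace ℝ (Fin n)} (hv : v ≠ 0) {t : ℝ} (ht : 0 < t) :
    0 ≤ (n - 1 + (radialChristoffel e (t • v)).trace) / t ∧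
      (n - 1 + (radialChristoffel e (t • v)).trace) / t ≤ (n - 1) / t := by
  have hc : (0 : ℝ) < n - 1 := by
    have : (2 : ℝ) ≤ n := by exact_mod_cast hn
    linarith
  set H : ℝ → ℝ := fun s => (n - 1 + (radialChristoffel e (s • v)).trace) / s with hH
  have hd (s : ℝ) (hs : 0 < s) := ((hasDerivAt_comp_smul he.differentiable_trace_radialChristoffel v
    s).const_add (n - 1 : ℝ)).fun_div (hasDerivAt_id s) hs.ne'
  have hR (s : ℝ) (hs : 0 < s) : deriv H s ≤ -(H s ^ 2 / (n - 1 : ℝ)) := by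
    have h1 := he.riccati_trace_radialChristoffel hn (smul_ne_zero hs.ne' hv) (hRic (s • v))
    simp only [PiLp.smul_apply, smul_eq_mul, mul_assoc, ← Finset.mul_sum] at h1
    have h2 : deriv H s = _ := (hd s hs).deriv
    rw [h2]
    simp only [id, mul_one]
    have h3 : -(H s ^ 2 / (n - 1 : ℝ)) = (-(radialChristoffel e (s • v)).trace -
        (radialChristoffel e (s • v)).trace ^ 2 / (n - 1 : ℝ) -
          (n - 1 + (radialChristoffel e (s • v)).trace)) / s ^ 2 := by
      simp only [hH]
      field_simp
      ring
    rw [h3]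
    gcongr
    linarith
  have hdiff (s : ℝ) (hs : 0 < s) : DifferentiableAt ℝ H s := (hd s hs).differentiableAt
  exact ⟨nonneg_of_riccati hc hdiff hR ht, le_div_of_riccati hc hdiff hR ht⟩

end IsNormalChart

end NormalChart

/-! ### Normal coordinates at a pole -/

section Chart

variable {n : ℕ} {M : Type*} [TopologicalSpace M] [ChartedSpace (EuclideanSpace ℝ (Fin n)) M]

/-- The global chart of `M` that is the inverse of a diffeomorphism `ℝⁿ → M`. -/
noncomputable def diffeoChart (Ψ : EuclideanSpace ℝ (Fin n) ≃ₘ^∞⟮𝓡 n, 𝓡 n⟯ M) :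
    OpenPartialHomeomorph M (EuclideanSpace ℝ (Fin n)) :=
  Ψ.symm.toHomeomorph.toOpenPartialHomeomorph

lemma diffeoChart_mem_maximalAtlas [IsManifold (𝓡 n) ∞ M]
    (Ψ : EuclideanSpace ℝ (Fin n) ≃ₘ^∞⟮𝓡 n, 𝓡 n⟯ M) :
    diffeoChart Ψ ∈ IsManifold.maximalAtlas (𝓡 n) ∞ M := by
  intro e' he'
  have he : e' ∈ IsManifold.maximalAtlas (𝓡 n) ∞ M := IsManifold.subset_maximalAtlas he'
  rw [contDiffGroupoid, mem_groupoid_of_pregroupoid, mem_groupoid_of_pregroupoid]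
  have h1 : ContMDiffOn (𝓡 n) (𝓡 n) ∞ (e' ∘ Ψ) (Ψ ⁻¹' e'.source) :=
    (contMDiffOn_of_mem_maximalAtlas he).comp Ψ.contMDiff.contMDiffOn (Set.Subset.refl _)
  have h2 : ContMDiffOn (𝓡 n) (𝓡 n) ∞ (Ψ.symm ∘ e'.symm) e'.target :=
    Ψ.symm.contMDiff.comp_contMDiffOn (contMDiffOn_symm_of_mem_maximalAtlas he)
  rw [contMDiffOn_iff_contDiffOn] at h1 h2
  refine ⟨⟨?_, ?_⟩, ⟨?_, ?_⟩⟩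
  · refine ContDiffOn.congr_mono h1 (fun x _ => rfl) ?_
    intro x hx; simpa [diffeoChart] using hx
  · refine ContDiffOn.congr_mono h2 (fun x _ => rfl) ?_
    intro x hx; simpa [diffeoChart] using hx
  · refine ContDiffOn.congr_mono h2 (fun x _ => rfl) ?_
    intro x hx; simpa [diffeoChart] using hx
  · refine ContDiffOn.congr_mono h1 (fun x _ => rfl) ?_
    intro x hx; simpa [diffeoChart] using hx

variable [RiemannianBundle (fun x : M => TangentSpace (𝓡 n) x)]

lemma contDiff_metricMatrix_diffeoChart [IsManifold (𝓡 n) ∞ M]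
    [IsContMDiffRiemannianBundle (𝓡 n) ∞ (EuclideanSpace ℝ (Fin n))
      (fun x : M => TangentSpace (𝓡 n) x)]
    (Ψ : EuclideanSpace ℝ (Fin n) ≃ₘ^∞⟮𝓡 n, 𝓡 n⟯ M) (i j : Fin n) :
    ContDiff ℝ ∞ (fun y => metricMatrix (diffeoChart Ψ) y i j) := by
  rw [← contMDiff_iff_contDiff]
  have key (i : Fin n) : ContMDiff (𝓡 n) ((𝓡 n).prod (𝓡 n)) ∞
      (fun y => (⟨Ψ y, coordVector (diffeoChart Ψ) y i⟩ : TangentBundle (𝓡 n) M)) := by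
    have h1 := Ψ.contMDiff.contMDiff_tangentMap (m := ∞) (by simp)
    have h2 : ContMDiff (𝓡 n) ((𝓡 n).prod (𝓡 n)) ∞
        (fun y : EuclideanSpace ℝ (Fin n) => (⟨y, EuclideanSpace.single i (1 : ℝ)⟩ :
          TangentBundle (𝓡 n) (EuclideanSpace ℝ (Fin n)))) := by
      intro y
      rw [contMDiffAt_totalSpace]
      refine ⟨contMDiffAt_id, ?_⟩
      simp
      exact contMDiffAt_const
    exact h1.comp h2
  exact (key i).inner_bundle (key j)

lemma posDef_metricMatrix_diffeoChart
    (Ψ : EuclideanSpace ℝ (Fin n) ≃ₘ^∞⟮𝓡 n, 𝓡 n⟯ M) (y : EuclideanSpace ℝ (Fin n)) :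
    (metricMatrix (diffeoChart Ψ) y).PosDef := by
  have hli : LinearIndependent ℝ (fun i => coordVector (diffeoChart Ψ) y i) := by
    have h0 : LinearIndependent ℝ (fun i : Fin n => EuclideanSpace.single i (1 : ℝ)) := by
      have he : (fun i : Fin n => EuclideanSpace.single i (1 : ℝ)) =
          (EuclideanSpace.basisFun (Fin n) ℝ).toBasis := by
        ext i
        simp
      rw [he]
      exact (EuclideanSpace.basisFun (Fin n) ℝ).toBasis.linearIndependent
    exact LinearIndependent.map' h0
      (Ψ.mfderivToContinuousLinearEquiv (by simp) y).toLinearEquiv.toLinearMap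
      (LinearEquiv.ker _)
  exact Matrix.posDef_gram_of_linearIndependent hli

end Chart

section Pole

variable {n : ℕ} {M : Type*} [TopologicalSpace M] [ChartedSpace (EuclideanSpace ℝ (Fin n)) M]
  [RiemannianBundle (fun x : M => TangentSpace (𝓡 n) x)]

/-- In the chart given by the exponential map and a linear identification `L` of `T_p M` with `ℝⁿ`, the
geodesic with initial velocity `L⁻¹ v` is the line `t ↦ t v`, and its equation is `Γᵏ_ij(t v) vⁱ vʲ = 0`. -/
lemma IsExponentialMap.christoffel_radial [IsManifold (𝓡 n) ∞ M] {p : M}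
    {f : TangentSpace (𝓡 n) p → M} (hf : IsExponentialMap p f)
    (L : TangentSpace (𝓡 n) p ≃L[ℝ] EuclideanSpace ℝ (Fin n))
    (Ψ : EuclideanSpace ℝ (Fin n) ≃ₘ^∞⟮𝓡 n, 𝓡 n⟯ M) (hΨ : ∀ y, Ψ y = f (L.symm y))
    (t : ℝ) (v : EuclideanSpace ℝ (Fin n)) (k : Fin n) :
    ∑ i, ∑ j, christoffel (diffeoChart Ψ) k i j (t • v) * v i * v j = 0 := by
  have h := (hf (L.symm v)).1.2 (diffeoChart Ψ) (diffeoChart_mem_maximalAtlas Ψ) t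
    (by simp [diffeoChart]) k
  have h1 (s : ℝ) : diffeoChart Ψ (f (s • L.symm v)) = s • v := by
    rw [← map_smul, ← hΨ]
    exact Ψ.symm_apply_apply _
  have h2 (i : Fin n) : deriv (fun s : ℝ => s * v i) = fun _ => v i := by
    ext s; simp
  simpa [h1, h2] using h

/-- The metric at equal base points, for vectors whose types agree only up to that equality. -/
lemma inner_eq_inner_of_totalSpace_eq {x x' : M} {u w : TangentSpace (𝓡 n) x}
    {u' w' : TangentSpace (𝓡 n) x'} (hu : (⟨x, u⟩ : TangentBundle (𝓡 n) M) = ⟨x', u'⟩)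
    (hw : (⟨x, w⟩ : TangentBundle (𝓡 n) M) = ⟨x', w'⟩) : inner ℝ u w = inner ℝ u' w' := by
  cases hu
  cases hw
  rfl

/-- At a pole, `exp_p` gives global normal coordinates. For `L` the coordinates of `T_p M` in the orthonormal
basis used in `normalVolumeDensity`, that density is the square root of `det g` in the chart. -/
lemma IsPole.exists_normalChart [IsManifold (𝓡 n) ∞ M]
    [IsContMDiffRiemannianBundle (𝓡 n) ∞ (EuclideanSpace ℝ (Fin n))
      (fun x : M => TangentSpace (𝓡 n) x)] {p : M} (hp : IsPole n p) :
    ∃ (L : TangentSpace (𝓡 n) p ≃L[ℝ] EuclideanSpace ℝ (Fin n))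
      (Ψ : EuclideanSpace ℝ (Fin n) ≃ₘ^∞⟮𝓡 n, 𝓡 n⟯ M),
      IsNormalChart (diffeoChart Ψ) ∧
      ∀ v, normalVolumeDensity n p v = √(metricMatrix (diffeoChart Ψ) (L v)).det := by
  obtain ⟨hex, Φ, hΦ⟩ := hp
  have hexp : IsExponentialMap p (expMap n p) := by
    rw [expMap, dif_pos hex]
    exact hex.choose_spec
  have hfin : Module.finrank ℝ (TangentSpace (𝓡 n) p) = n :=
    finrank_euclideanSpace_fin (𝕜 := ℝ) (n := n)
  let b := stdOrthonormalBasis ℝ (TangentSpace (𝓡 n) p)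
  let c := b.reindex (finCongr hfin)
  let L : TangentSpace (𝓡 n) p ≃L[ℝ] EuclideanSpace ℝ (Fin n) :=
    c.repr.toContinuousLinearEquiv
  let Ψ : EuclideanSpace ℝ (Fin n) ≃ₘ^∞⟮𝓡 n, 𝓡 n⟯ M := L.symm.toDiffeomorph.trans Φ
  have hΨ (y) : Ψ y = expMap n p (L.symm y) := congrFun hΦ _
  refine ⟨L, Ψ, ⟨contDiff_metricMatrix_diffeoChart Ψ, posDef_metricMatrix_diffeoChart Ψ,
    hexp.christoffel_radial L Ψ hΨ⟩, fun v => ?_⟩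
  have hL (i) : L.symm (EuclideanSpace.single (finCongr hfin i) 1) = b i := by
    have : L.symm (EuclideanSpace.single (finCongr hfin i) 1) = c (finCongr hfin i) :=
      c.repr_symm_single _
    rw [this]
    simp [c]
  have hΨ' : (Ψ : EuclideanSpace ℝ (Fin n) → M) = expMap n p ∘ L.symm := funext hΨ
  have hexpd : MDifferentiable 𝓘(ℝ, TangentSpace (𝓡 n) p) (𝓡 n) (expMap n p) := by
    rw [← hΦ]
    exact Φ.contMDiff.mdifferentiable (by simp)
  have hcoord (i) : (⟨Ψ (L v), coordVector (diffeoChart Ψ) (L v) (finCongr hfin i)⟩ :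
      TangentBundle (𝓡 n) M) = ⟨expMap n p v, dexp n p v (b i)⟩ := by
    have hLd : tangentMap (𝓡 n) 𝓘(ℝ, TangentSpace (𝓡 n) p) L.symm
        ⟨L v, EuclideanSpace.single (finCongr hfin i) (1 : ℝ)⟩ = ⟨v, b i⟩ := by
      rw [tangentMap, mfderiv_eq_fderiv, L.symm.fderiv, ← hL i]
      exact congrArg (fun z => (⟨z, L.symm (EuclideanSpace.single (finCongr hfin i) (1 : ℝ))⟩ :
        TangentBundle 𝓘(ℝ, TangentSpace (𝓡 n) p) (TangentSpace (𝓡 n) p))) (L.symm_apply_apply v)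
    have h1 : (⟨Ψ (L v), coordVector (diffeoChart Ψ) (L v) (finCongr hfin i)⟩ :
        TangentBundle (𝓡 n) M) = tangentMap (𝓡 n) (𝓡 n) Ψ
          ⟨L v, EuclideanSpace.single (finCongr hfin i) (1 : ℝ)⟩ := rfl
    rw [h1, hΨ', tangentMap_comp_at _ (hexpd _)
      (L.symm.differentiableAt.mdifferentiableAt), hLd]
    rfl
  have : metricMatrix (diffeoChart Ψ) (L v) = (Matrix.of fun i j =>
      inner ℝ (dexp n p v (b i)) (dexp n p v (b j))).reindex (finCongr hfin) (finCongr hfin) := by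
    ext i j
    obtain ⟨i, rfl⟩ := (finCongr hfin).surjective i
    obtain ⟨j, rfl⟩ := (finCongr hfin).surjective j
    simp only [Matrix.reindex_apply, Matrix.submatrix_apply, Equiv.symm_apply_apply,
      Matrix.of_apply]
    exact inner_eq_inner_of_totalSpace_eq (hcoord i) (hcoord j)
  rw [this, Matrix.det_reindex_self]
  rfl

end Pole

end PoleManifold

theorem mainTheorem5 {M : Type*} [TopologicalSpace M]
    [ChartedSpace (EuclideanSpace ℝ (Fin 3)) M] [IsManifold (𝓡 3) ∞ M]
    [RiemannianBundle (fun x : M => TangentSpace (𝓡 3) x)]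
    [IsContMDiffRiemannianBundle (𝓡 3) ∞ (EuclideanSpace ℝ (Fin 3))
      (fun x : M => TangentSpace (𝓡 3) x)]
    (p : M) (hp : PoleManifold.IsPole 3 p) (hRic : PoleManifold.RicciNonneg 3 M)
    (t : ℝ) (ht : 0 < t) (θ : TangentSpace (𝓡 3) p) (hθ : ‖θ‖ = 1) :
    0 < PoleManifold.polarDensity 3 p t θ ∧
      DifferentiableAt ℝ (fun s => PoleManifold.polarDensity 3 p s θ) t ∧
      0 ≤ deriv (fun s => PoleManifold.polarDensity 3 p s θ) t /
        PoleManifold.polarDensity 3 p t θ ∧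
      deriv (fun s => PoleManifold.polarDensity 3 p s θ) t /
        PoleManifold.polarDensity 3 p t θ ≤ 2 / t := by
  obtain ⟨L, Ψ, he, hdens⟩ := hp.exists_normalChart
  set e := PoleManifold.diffeoChart Ψ
  have hθ0 : L θ ≠ 0 := by
    rw [ne_eq, L.map_eq_zero_iff]
    rintro rfl
    simp at hθ
  have hJ : (fun s => PoleManifold.polarDensity 3 p s θ) = fun s : ℝ =>
      s ^ (3 - 1) * √(PoleManifold.metricMatrix e (s • L θ)).det := by
    ext s
    rw [PoleManifold.polarDensity, hdens, map_smul]
  have hpos : 0 < PoleManifold.polarDensity 3 p t θ := by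
    rw [congrFun hJ t]
    exact mul_pos (pow_pos ht _) (Real.sqrt_pos.2 (he.posDef_metric _).det_pos)
  have hderiv := he.hasDerivAt_pow_mul_sqrt_det (by norm_num) (L θ) ht
  rw [← hJ, ← congrFun hJ t] at hderiv
  have hbound := he.meanCurvature_bounds (by norm_num) (fun y => hRic e
    (PoleManifold.diffeoChart_mem_maximalAtlas Ψ) y (by simp [e, PoleManifold.diffeoChart]) y)
    hθ0 ht
  rw [hderiv.deriv, mul_div_cancel_left₀ _ hpos.ne']
  refine ⟨hpos, hderiv.differentiableAt, hbound.1, hbound.2.trans_eq ?_⟩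
  norm_num
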